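/- Let $d\in\mathbb N$, let $\langle\cdot,\cdot\rangle$ and $\|\cdot\|$ be the Euclidean inner product and norm of $\mathbb R^{d}$, and write $f^*(z):=\sup_{x}\big(\langle x,z\rangle-f(x)\big)$ for the Fenchel conjugate of $f:\mathbb R^{d}\to(-\infty,\infty]$. Let $\beta\in(0,1)$ and let $D:\mathbb R^{d}\to\mathbb R^{d}$ be a MoL-Grad denoiser with parameter $\beta$, i.e. $D$ is $\beta^{-1}$-Lipschitz continuous and $D=\nabla\psi$ for a differentiable convex function $\psi:\mathbb R^{d}\to\mathbb R$. Put $\varphi:=\psi^*-\tfrac12\|\cdot\|^2$. Then $D$ is the (single-valued) proximity operator of $\varphi$: for every $x$, $D(x)$ is the unique minimizer of $\varphi+\tfrac12\|x-\cdot\|^2$. Moreover, let $\mathcal M\subset\mathbb R^{d}$ be a linear subspace, with orthogonal complement $\mathcal M^\perp$ and orthogonal projections $P_{\mathcal M}$, $P_{\mathcal M^\perp}$. Let $\mu,\kappa>0$, and let $\Phi:\mathbb R^{d}\to\mathbb R$ be a convex function, differentiable with Lipschitz continuous gradient, that is $(1/\mu)$-strongly convex over $\mathcal M$ and such that $h:=\mu\Phi-\tfrac12\|P_{\mathcal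 M}\,\cdot\|^2$ is convex and $\kappa$-smooth (differentiable with $\kappa$-Lipschitz continuous gradient) on $\mathbb R^{d}$. Let $\sigma,\tau>0$ satisfy (i) $\sigma\le\dfrac{\beta}{1-\beta}$ and (ii) $\tau\left(\sigma+\dfrac{\kappa}{2}\right)<1$. For arbitrary $(v_0,u_0)\in\mathbb R^{d}\times\mathbb R^{d}$ define, for $k=0,1,2,\dots$, $$\tilde u_{k+1}:=u_k+\sigma v_k,\qquad u_{k+1}:=\tilde u_{k+1}-\sigma D\big(\tilde u_{k+1}/(\sigma+1)\big),$$ $$\tilde v_{k+1}:=\tau\,\nabla\big(\mu\Phi+\tfrac12\|P_{\mathcal M^\perp}\,\cdot\|^2\big)(v_k),\qquad v_{k+1}:=(1+\tau)v_k-\tilde v_{k+1}-\tau(2u_{k+1}-u_k).$$ Then $(v_k)$ converges to a solution of the primal problem $$\min_{v\in\mathbb R^{d}}\ \mu\Phi(v)+(\sigma+1)\varphi(v)+\tfrac12\|P_{\mathcal M^\perp}v\|^2$$ and $(u_k)$ converges to a solution of the dual problem $$\min_{u\in\mathbb R^{d}}\ h^*(-u)+\big[(\sigma+1)\varphi+\tfrac12\|\cdot\|^2\big]^*(u),$$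 provided that such (primal and dual) solutions exist. -/

import Mathlib

noncomputable section

open scoped Gradient

/-- `ℝ^d` with the `ℓ₂` norm. -/
abbrev Euc (d : ℕ) : Type := EuclideanSpace ℝ (Fin d)

/-- Fenchel conjugate `f* : z ↦ sup_x (⟨x, z⟩ - f x)` of an extended-real-valued function. -/
def fenchelConj {d : ℕ} (f : Euc d → EReal) : Euc d → EReal :=
  fun z => ⨆ x, (((inner ℝ x z : ℝ) : EReal) - f x)

/-- `f` is `κ`-smooth: differentiable everywhere with `κ`-Lipschitz gradient. -/
def IsSmoothWith {d : ℕ} (κ : ℝ) (f : Euc d → ℝ) : Prop :=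
  Differentiable ℝ f ∧ ∀ x y, ‖∇ f x - ∇ f y‖ ≤ κ * ‖x - y‖

/-- `D` is a MoL-Grad denoiser with parameter `β` and potential `ψ`: `D` is `β⁻¹`-Lipschitz
continuous and `D = ∇ψ` for the Fréchet differentiable convex function `ψ`. -/
structure IsMoLGrad {d : ℕ} (β : ℝ) (ψ : Euc d → ℝ) (D : Euc d → Euc d) : Prop where
  lipschitz : ∀ x y, ‖D x - D y‖ ≤ β⁻¹ * ‖x - y‖
  convex : ConvexOn ℝ Set.univ ψ
  gradient : ∀ x, HasGradientAt ψ (D x) x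

/-- The implicit regularizer `φ = ψ* - (1/2)‖·‖²`. -/
def implicitReg {d : ℕ} (ψ : Euc d → ℝ) : Euc d → EReal :=
  fun v => fenchelConj (fun x => (ψ x : EReal)) v - ((1 / 2 * ‖v‖ ^ 2 : ℝ) : EReal)

/-- `T` is the single-valued proximity operator of `f` of index `γ`: for every `x`, the point
`T x` is the unique minimizer of `f + (1/(2γ))‖x - ·‖²`. -/
def IsSProx {d : ℕ} (γ : ℝ) (f : Euc d → EReal) (T : Euc d → Euc d) : Prop :=
  ∀ x y, IsMinOn (fun z => f z + ((1 / (2 * γ) * ‖x - z‖ ^ 2 : ℝ) : EReal)) Set.univ y ↔ y = T x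

/-- `h = μΦ - (1/2)‖P_M ·‖²`. -/
def hFun {d : ℕ} (M : Submodule ℝ (Euc d)) (μ : ℝ) (Φ : Euc d → ℝ) : Euc d → ℝ :=
  fun v => μ * Φ v - 1 / 2 * ‖M.starProjection v‖ ^ 2

/-- `μΦ + (1/2)‖P_{Mᗮ} ·‖²`. -/
def penalizedFidelity {d : ℕ} (M : Submodule ℝ (Euc d)) (μ : ℝ) (Φ : Euc d → ℝ) : Euc d → ℝ :=
  fun v => μ * Φ v + 1 / 2 * ‖Mᗮ.starProjection v‖ ^ 2

/-- The pairs `(v_k, u_k)` generated by the primal-dual algorithm from `(v₀, u₀)`. -/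
def primalDualIter {d : ℕ} (D : Euc d → Euc d) (M : Submodule ℝ (Euc d)) (μ : ℝ)
    (Φ : Euc d → ℝ) (σ τ : ℝ) (v₀ u₀ : Euc d) : ℕ → Euc d × Euc d
  | 0 => (v₀, u₀)
  | k + 1 =>
    let v := (primalDualIter D M μ Φ σ τ v₀ u₀ k).1
    let u := (primalDualIter D M μ Φ σ τ v₀ u₀ k).2
    let uTilde := u + σ • v
    let uNext := uTilde - σ • D ((1 / (σ + 1)) • uTilde)
    let vTilde := τ • ∇ (penalizedFidelity M μ Φ) v
    let vNext := (1 + τ) • v - vTilde - τ • ((2 : ℝ) • uNext - u)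
    (vNext, uNext)

/-- Cost of the primal problem: `μΦ + (σ+1)φ + (1/2)‖P_{Mᗮ} ·‖²`. -/
def primalCost {d : ℕ} (ψ : Euc d → ℝ) (M : Submodule ℝ (Euc d)) (μ : ℝ) (Φ : Euc d → ℝ)
    (σ : ℝ) : Euc d → EReal :=
  fun v => ((μ * Φ v : ℝ) : EReal) + ((σ + 1 : ℝ) : EReal) * implicitReg ψ v
    + ((1 / 2 * ‖Mᗮ.starProjection v‖ ^ 2 : ℝ) : EReal)

/-- Cost of the (Fenchel) dual problem: `u ↦ h*(-u) + [(σ+1)φ + (1/2)‖·‖²]*(u)`. -/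
def dualCost {d : ℕ} (ψ : Euc d → ℝ) (M : Submodule ℝ (Euc d)) (μ : ℝ) (Φ : Euc d → ℝ)
    (σ : ℝ) : Euc d → EReal :=
  fun u => fenchelConj (fun v => (hFun M μ Φ v : EReal)) (-u)
    + fenchelConj (fun v => ((σ + 1 : ℝ) : EReal) * implicitReg ψ v
        + ((1 / 2 * ‖v‖ ^ 2 : ℝ) : EReal)) u

end

open scoped Gradient

/-! ### Convex functions with Lipschitz gradient. -/

section Smooth

variable {E : Type*} [NormedAddCommGroup E] [InnerProductSpace ℝ E] [CompleteSpace E]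

/-! Let g = (σ+1)φ + ½‖·‖² = (σ+1)ψ* - (σ/2)‖·‖². By Pythagoras the primal cost is h + g. As ψ is
β⁻¹-smooth, ψ* is β-strongly convex, so (i), i.e. σ ≤ (σ+1)β, makes g convex. Since D = ∇ψ, p =
D(w/(σ+1)) satisfies w - σp ∈ ∂g(p); hence w ↦ w - σp is the resolvent of σ(∂g)⁻¹, and the algorithm
is the Condat-Vũ iteration for u ∈ ∂g(v), ∇h(v) = -u.

The fixed points are exactly the pairs solving this system. The iteration is Fejér monotone towards
them in the gauge q(v,u) = ‖v‖²/τ + ‖u‖²/σ + 2⟨v,u⟩ (`primalDualStep_fejer`, which uses cocoercivity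
of ∇h); (ii) keeps the form positive definite after the loss of κ/2. Compactness then gives
convergence (`tendsto_iterate_of_fejer`). A primal minimizer supplies a fixed point, and any fixed
point is primal and dual optimal by Fenchel-Young. -/

theorem HasGradientAt.hasDerivAt_lineMap {f : E → ℝ} {g x d : E} {t : ℝ}
    (hf : HasGradientAt f g (x + t • d)) :
    HasDerivAt (fun s : ℝ => f (x + s • d)) (inner ℝ g d) t := by
  have h1 : HasDerivAt (fun s : ℝ => x + s • d) d t := by
    simpa using ((hasDerivAt_id t).smul_const d).const_add x
  exact (hf.hasFDerivAt.comp_hasDerivAt t h1).congr_deriv (by simp)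

/-- First-order characterization of convexity. -/
theorem ConvexOn.add_inner_le {f : E → ℝ} (hf : ConvexOn ℝ Set.univ f) {g x : E}
    (hg : HasGradientAt f g x) (y : E) : f x + inner ℝ g (y - x) ≤ f y := by
  have hc : ConvexOn ℝ Set.univ (fun s : ℝ => f (x + s • (y - x))) := by
    have := hf.comp_affineMap (AffineMap.lineMap x y : ℝ →ᵃ[ℝ] E)
    simpa [Function.comp_def, AffineMap.lineMap_apply, add_comm] using this
  have hd : HasDerivAt (fun s : ℝ => f (x + s • (y - x))) (inner ℝ g (y - x)) 0 :=
    HasGradientAt.hasDerivAt_lineMap (by simpa using hg)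
  have := hc.le_slope_of_hasDerivAt (Set.mem_univ 0) (Set.mem_univ 1) one_pos hd
  simp [slope_def_field] at this
  linarith

/-- The descent lemma. -/
theorem le_add_inner_add_sq_of_lipschitz_gradient {f : E → ℝ} {G : E → E} {L : ℝ}
    (hG : ∀ x, HasGradientAt f (G x) x) (hL : ∀ x y, ‖G x - G y‖ ≤ L * ‖x - y‖) (x d : E) :
    f (x + d) ≤ f x + inner ℝ (G x) d + L / 2 * ‖d‖ ^ 2 := by
  let F : ℝ → ℝ := fun t => f (x + t • d) - t * inner ℝ (G x) d - L / 2 * ‖d‖ ^ 2 * t ^ 2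
  have hF (t : ℝ) : HasDerivAt F
      (inner ℝ (G (x + t • d)) d - inner ℝ (G x) d - L / 2 * ‖d‖ ^ 2 * (2 * t)) t := by
    have h1 := (hG (x + t • d)).hasDerivAt_lineMap
    have h2 := (hasDerivAt_id t).mul_const (inner ℝ (G x) d)
    have h3 := (hasDerivAt_pow 2 t).const_mul (L / 2 * ‖d‖ ^ 2)
    exact ((h1.sub h2).sub h3).congr_deriv (by simp)
  have hanti : AntitoneOn F (Set.Ici 0) := by
    refine antitoneOn_of_deriv_nonpos (convex_Ici 0)
      (fun t _ => (hF t).continuousAt.continuousWithinAt)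
      (fun t _ => (hF t).differentiableAt.differentiableWithinAt) fun t ht => ?_
    rw [interior_Ici, Set.mem_Ioi] at ht
    rw [(hF t).deriv, ← inner_sub_left]
    have h1 := real_inner_le_norm (G (x + t • d) - G x) d
    have h2 := hL (x + t • d) x
    rw [add_sub_cancel_left, norm_smul, Real.norm_of_nonneg ht.le] at h2
    have h3 := mul_le_mul_of_nonneg_right h2 (norm_nonneg d)
    linarith
  have := hanti (Set.mem_Ici.2 le_rfl) (Set.mem_Ici.2 zero_le_one) zero_le_one
  simp [F] at this
  linarith

/-- The Baillon-Haddad theorem: the gradient of a convex smooth function is cocoercive. -/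
theorem cocoercive_of_lipschitz_gradient {f : E → ℝ} {G : E → E} {L : ℝ} (hL0 : 0 < L)
    (hf : ConvexOn ℝ Set.univ f) (hG : ∀ x, HasGradientAt f (G x) x)
    (hL : ∀ x y, ‖G x - G y‖ ≤ L * ‖x - y‖) (x y : E) :
    ‖G x - G y‖ ^ 2 ≤ L * inner ℝ (G x - G y) (x - y) := by
  have key (x y : E) : f x + inner ℝ (G x) (y - x) + 1 / (2 * L) * ‖G y - G x‖ ^ 2 ≤ f y := by
    -- The test point minimizes over d the descent-lemma bound at y + d for f - ⟨G x, ·⟩.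
    have h1 := hf.add_inner_le (hG x) (y + (-(1 / L)) • (G y - G x))
    have h2 := le_add_inner_add_sq_of_lipschitz_gradient hG hL y ((-(1 / L)) • (G y - G x))
    have h3 := real_inner_self_eq_norm_sq (G y - G x)
    rw [add_sub_right_comm, inner_add_right, real_inner_smul_right] at h1
    rw [real_inner_smul_right, norm_smul, mul_pow, Real.norm_eq_abs, sq_abs] at h2
    rw [inner_sub_left] at h3
    have h4 : L / 2 * ((-(1 / L)) ^ 2 * ‖G y - G x‖ ^ 2) = 1 / (2 * L) * ‖G y - G x‖ ^ 2 := by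
      field_simp
    have h5 : 1 / L * ‖G y - G x‖ ^ 2 = 2 * (1 / (2 * L) * ‖G y - G x‖ ^ 2) := by
      field_simp
    have h6 : 1 / L * inner ℝ (G y) (G y - G x) - 1 / L * inner ℝ (G x) (G y - G x)
        = 1 / L * ‖G y - G x‖ ^ 2 := by
      rw [← h3]; ring
    linarith
  have h1 := key x y
  have h2 := key y x
  have h3 : inner ℝ (G x - G y) (x - y) = -inner ℝ (G x) (y - x) - inner ℝ (G y) (x - y) := by
    rw [← neg_sub y x, inner_sub_left, inner_neg_right, inner_neg_right]
  rw [norm_sub_rev (G y)] at h1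
  have h4 : 2 * (1 / (2 * L) * ‖G x - G y‖ ^ 2) ≤ inner ℝ (G x - G y) (x - y) := by
    rw [h3]; linarith
  calc ‖G x - G y‖ ^ 2 = L * (2 * (1 / (2 * L) * ‖G x - G y‖ ^ 2)) := by field_simp
    _ ≤ _ := by gcongr

end Smooth

/-! ### Fejér monotone iterations. -/

section Fejer

open Filter Topology

/-- Convergence of the iterates of a continuous map that is Fejér monotone with respect to its
fixed points, measured by a gauge `q` that dominates the squared norm. -/
theorem tendsto_iterate_of_fejer {X : Type*} [NormedAddCommGroup X] [ProperSpace X]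
    {T : X → X} (hT : Continuous T) {q : X → ℝ} (hq : Continuous q) (hq0 : q 0 = 0) {c : ℝ}
    (hc : 0 < c) (hqc : ∀ z, c * ‖z‖ ^ 2 ≤ q z)
    (hF : ∀ z', T z' = z' → ∀ z, q (T z - z') + c * ‖T z - z‖ ^ 2 ≤ q (z - z'))
    (hfix : ∃ z', T z' = z') (z₀ : X) :
    ∃ z', T z' = z' ∧ Tendsto (fun k => T^[k] z₀) atTop (𝓝 z') := by
  have hqn (z : X) : 0 ≤ q z := (by positivity : 0 ≤ c * ‖z‖ ^ 2).trans (hqc z)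
  have step (z' : X) (hz' : T z' = z') (k : ℕ) :
      q (T^[k + 1] z₀ - z') + c * ‖T^[k + 1] z₀ - T^[k] z₀‖ ^ 2 ≤ q (T^[k] z₀ - z') := by
    rw [Function.iterate_succ_apply']
    exact hF z' hz' _
  have anti (z' : X) (hz' : T z' = z') : Antitone fun k => q (T^[k] z₀ - z') :=
    antitone_nat_of_succ_le fun k => by
      have := step z' hz' k
      have : 0 ≤ c * ‖T^[k + 1] z₀ - T^[k] z₀‖ ^ 2 := by positivity
      linarith
  have norm_zero {w : ℕ → X} (hw : Tendsto (fun k => c * ‖w k‖ ^ 2) atTop (𝓝 0)) :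
      Tendsto w atTop (𝓝 0) := by
    have h1 : Tendsto (fun k => ‖w k‖ ^ 2) atTop (𝓝 0) := by
      simpa [hc.ne'] using hw.const_mul c⁻¹
    have h2 := h1.sqrt
    simp only [Real.sqrt_zero, Real.sqrt_sq (norm_nonneg _)] at h2
    exact tendsto_zero_iff_norm_tendsto_zero.2 h2
  obtain ⟨a, ha⟩ := hfix
  have hdiff : Tendsto (fun k => T^[k + 1] z₀ - T^[k] z₀) atTop (𝓝 0) := by
    obtain ⟨l, hl⟩ : ∃ l, Tendsto (fun k => q (T^[k] z₀ - a)) atTop (𝓝 l) :=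
      ⟨_, tendsto_atTop_ciInf (anti a ha) ⟨0, by rintro _ ⟨k, rfl⟩; exact hqn _⟩⟩
    have h1 := hl.sub ((tendsto_add_atTop_iff_nat 1).2 hl)
    rw [sub_self] at h1
    refine norm_zero (squeeze_zero (fun k => by positivity) (fun k => ?_) h1)
    have := step a ha k
    linarith
  have hbdd (k : ℕ) : T^[k] z₀ ∈ Metric.closedBall a (√(q (z₀ - a) / c)) := by
    rw [mem_closedBall_iff_norm]
    refine Real.le_sqrt_of_sq_le ?_
    rw [le_div_iff₀' hc]
    exact (hqc _).trans (anti a ha (Nat.zero_le k))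
  obtain ⟨z', -, s, hs, hlim⟩ := tendsto_subseq_of_bounded Metric.isBounded_closedBall hbdd
  have hz' : T z' = z' := by
    have h1 : Tendsto (fun k => T (T^[s k] z₀)) atTop (𝓝 (T z')) :=
      (hT.tendsto z').comp hlim
    have h2 := (hdiff.comp hs.tendsto_atTop).add hlim
    simp only [Function.comp_def, sub_add_cancel, zero_add, Function.iterate_succ_apply'] at h2
    exact tendsto_nhds_unique h1 h2
  refine ⟨z', hz', ?_⟩
  have h1 : Tendsto (fun k => q (T^[s k] z₀ - z')) atTop (𝓝 0) := by
    have := (hq.tendsto 0).comp (by simpa using hlim.sub_const z' :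
      Tendsto (fun k => T^[s k] z₀ - z') atTop (𝓝 0))
    rwa [hq0] at this
  -- The cluster point is itself fixed, so the gauge distance to it is antitone and its limit along
  -- a subsequence is its limit.
  have h2 : Tendsto (fun k => q (T^[k] z₀ - z')) atTop (𝓝 0) :=
    (tendsto_iff_tendsto_subseq_of_antitone (anti z' hz') hs.tendsto_atTop).2 h1
  have h3 := norm_zero (squeeze_zero (fun k => by positivity) (fun k => hqc _) h2)
  simpa using h3.add_const z'

end Fejer

/-! ### The Condat-Vũ iteration for a monotone relation. -/

section PrimalDual

open Filter Topology

variable {E : Type*} [NormedAddCommGroup E] [InnerProductSpace ℝ E]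

theorem exists_pos_mul_le_quadratic {α σ : ℝ} (hσ : 0 < σ) (hα : σ < α) :
    ∃ c > 0, ∀ a b : E, c * (‖a‖ ^ 2 + ‖b‖ ^ 2)
      ≤ α * ‖a‖ ^ 2 + 1 / σ * ‖b‖ ^ 2 + 2 * inner ℝ a b := by
  obtain ⟨s, hs, hs'⟩ := exists_between hα
  have hs0 : 0 < s := hσ.trans hs
  have h1 : 0 < 1 / σ - 1 / s := sub_pos.2 (one_div_lt_one_div_of_lt hσ hs)
  refine ⟨min (α - s) (1 / σ - 1 / s), lt_min (sub_pos.2 hs') h1, fun a b => ?_⟩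
  have h2 : 0 ≤ s * ‖a + (1 / s) • b‖ ^ 2 := by positivity
  rw [norm_add_sq_real, real_inner_smul_right, norm_smul, mul_pow, Real.norm_eq_abs, sq_abs] at h2
  have h3 : s * (‖a‖ ^ 2 + 2 * (1 / s * inner ℝ a b) + (1 / s) ^ 2 * ‖b‖ ^ 2)
      = s * ‖a‖ ^ 2 + 2 * inner ℝ a b + 1 / s * ‖b‖ ^ 2 := by
    field_simp
  have h4 := mul_le_mul_of_nonneg_right (min_le_left (α - s) (1 / σ - 1 / s)) (sq_nonneg ‖a‖)
  have h5 := mul_le_mul_of_nonneg_right (min_le_right (α - s) (1 / σ - 1 / s)) (sq_nonneg ‖b‖)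
  linarith

/-- One step of the primal-dual algorithm for the inclusion `0 ∈ G v + A v`, where `J` is the
resolvent of `σ A⁻¹`. -/
def primalDualStep (G J : E → E) (σ τ : ℝ) (z : E × E) : E × E :=
  (z.1 - τ • (G z.1 + ((2 : ℝ) • J (z.2 + σ • z.1) - z.2)), J (z.2 + σ • z.1))

variable {A : E → E → Prop} {G J : E → E} {σ τ κ : ℝ}

theorem fixed_primalDualStep_iff
    (hA : ∀ p u p' u', A p u → A p' u' → 0 ≤ inner ℝ (u - u') (p - p'))
    (hσ : 0 < σ) (hτ : 0 < τ) (hJ : ∀ w, A ((1 / σ) • (w - J w)) (J w)) (v u : E) :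
    primalDualStep G J σ τ (v, u) = (v, u) ↔ A v u ∧ G v = -u := by
  constructor
  · intro h
    simp only [primalDualStep, Prod.mk.injEq] at h
    obtain ⟨h1, h2⟩ := h
    rw [h2] at h1
    have h3 := hJ (u + σ • v)
    rw [h2, add_sub_cancel_left, smul_smul, one_div_mul_cancel hσ.ne', one_smul] at h3
    refine ⟨h3, ?_⟩
    have h4 : G v + ((2 : ℝ) • u - u) = 0 := by
      simpa only [sub_eq_self, smul_eq_zero, hτ.ne', false_or] using h1
    rw [two_smul, add_sub_cancel_right] at h4
    exact eq_neg_of_add_eq_zero_left h4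
  · rintro ⟨h1, h2⟩
    have h3 : J (u + σ • v) = u := by
      have h4 := hA _ _ _ _ (hJ (u + σ • v)) h1
      have h5 : (1 / σ) • (u + σ • v - J (u + σ • v)) - v = (-(1 / σ)) • (J (u + σ • v) - u) := by
        have : v = (1 / σ) • σ • v := by rw [smul_smul, one_div_mul_cancel hσ.ne', one_smul]
        nth_rw 3 [this]
        module
      rw [h5, real_inner_smul_right, real_inner_self_eq_norm_sq] at h4
      have h6 : 0 < 1 / σ := by positivity
      have h7 : ‖J (u + σ • v) - u‖ ^ 2 ≤ 0 := by nlinarith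
      rw [← sub_eq_zero, ← norm_eq_zero]
      exact pow_eq_zero_iff two_ne_zero |>.1 (le_antisymm h7 (sq_nonneg _))
    simp only [primalDualStep, h3, h2]
    simp [two_smul]

/-- Twice the sum of monotonicity of `A` at the new dual point and cocoercivity of `G` at the old
primal point. The latter mismatch costs κ/2 in the coefficient of ‖v₁ - v‖². -/
theorem primalDualStep_fejer
    (hA : ∀ p u p' u', A p u → A p' u' → 0 ≤ inner ℝ (u - u') (p - p'))
    (hG : ∀ x y, ‖G x - G y‖ ^ 2 ≤ κ * inner ℝ (G x - G y) (x - y)) (hκ : 0 < κ)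
    (hσ : 0 < σ) (hτ : 0 < τ) (hJ : ∀ w, A ((1 / σ) • (w - J w)) (J w))
    {v' u' v u v₁ u₁ : E} (hz : A v' u') (hz' : G v' = -u')
    (h₁ : primalDualStep G J σ τ (v, u) = (v₁, u₁)) :
    1 / τ * ‖v₁ - v'‖ ^ 2 + 1 / σ * ‖u₁ - u'‖ ^ 2 + 2 * inner ℝ (v₁ - v') (u₁ - u')
      + ((1 / τ - κ / 2) * ‖v₁ - v‖ ^ 2 + 1 / σ * ‖u₁ - u‖ ^ 2 + 2 * inner ℝ (v₁ - v) (u₁ - u))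
      ≤ 1 / τ * ‖v - v'‖ ^ 2 + 1 / σ * ‖u - u'‖ ^ 2 + 2 * inner ℝ (v - v') (u - u') := by
  simp only [primalDualStep, Prod.mk.injEq] at h₁
  obtain ⟨hv, hu⟩ := h₁
  rw [hu] at hv
  have m := hA _ _ _ _ (hJ (u + σ • v)) hz
  rw [hu] at m
  obtain ⟨a, rfl⟩ : ∃ a, v₁ = v + a := ⟨v₁ - v, by abel⟩
  obtain ⟨b, rfl⟩ : ∃ b, u₁ = u + b := ⟨u₁ - u, by abel⟩
  obtain ⟨x, rfl⟩ : ∃ x, v = v' + x := ⟨v - v', by abel⟩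
  obtain ⟨y, rfl⟩ : ∃ y, u = u' + y := ⟨u - u', by abel⟩
  have hp : (1 / σ) • (u' + y + σ • (v' + x) - (u' + y + b)) - v' = x - (1 / σ) • b := by
    have : x = (1 / σ) • σ • (v' + x) - v' := by
      rw [smul_smul, one_div_mul_cancel hσ.ne', one_smul]; abel
    nth_rw 2 [this]
    module
  rw [hp] at m
  have g := hG (v' + x) v'
  have hg : G (v' + x) - G v' = -(y + b) - b - (1 / τ) • a := by
    have : a = (-τ) • (G (v' + x) + ((2 : ℝ) • (u' + y + b) - (u' + y))) := by
      rw [neg_smul, ← add_right_inj (v' + x), ← sub_eq_add_neg, hv]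
    have h2 : (1 / τ) • a = -(G (v' + x) + ((2 : ℝ) • (u' + y + b) - (u' + y))) := by
      nth_rw 1 [this]
      rw [smul_smul, mul_neg, one_div_mul_cancel hτ.ne', neg_one_smul]
    rw [h2, hz']
    module
  rw [hg] at g
  -- Young's inequality in square form: it trades the ‖w‖² from cocoercivity for ⟨w, a⟩ + (κ/4)‖a‖².
  have sq : 0 ≤ ‖(-(y + b) - b - (1 / τ) • a) + (κ / 2) • a‖ ^ 2 := sq_nonneg _
  set w := -(y + b) - b - (1 / τ) • a with hw
  rw [norm_add_sq_real, real_inner_smul_right, norm_smul, mul_pow, Real.norm_eq_abs, sq_abs] at sq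
  have e1 : v' + x - v' = x := by abel
  rw [e1] at g
  have g2 : 0 ≤ inner ℝ w x + inner ℝ w a + κ / 4 * ‖a‖ ^ 2 := by
    have : 0 ≤ κ * (inner ℝ w x + inner ℝ w a + κ / 4 * ‖a‖ ^ 2) := by nlinarith
    exact nonneg_of_mul_nonneg_right this hκ
  have e2 : u' + y + b - u' = y + b := by abel
  have e3 : v' + x + a - v' = x + a := by abel
  have e4 : u' + y - u' = y := by abel
  have e5 : v' + x + a - (v' + x) = a := by abel
  have e6 : u' + y + b - (u' + y) = b := by abel
  rw [e1, e2, e3, e4, e5, e6]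
  rw [e2] at m
  rw [hw] at g2
  simp only [inner_add_left, inner_sub_left, inner_add_right, inner_sub_right, inner_neg_left,
    real_inner_smul_left, real_inner_smul_right, real_inner_self_eq_norm_sq,
    norm_add_sq_real] at m g2 ⊢
  simp only [real_inner_comm] at m g2 ⊢
  linarith

variable [FiniteDimensional ℝ E]

/-- Convergence of the primal-dual (Condat-Vũ) iteration. -/
theorem tendsto_iterate_primalDualStep
    (hA : ∀ p u p' u', A p u → A p' u' → 0 ≤ inner ℝ (u - u') (p - p'))
    (hG : ∀ x y, ‖G x - G y‖ ^ 2 ≤ κ * inner ℝ (G x - G y) (x - y)) (hGc : Continuous G)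
    (hκ : 0 < κ) (hσ : 0 < σ) (hτ : 0 < τ) (hστ : τ * (σ + κ / 2) < 1)
    (hJ : ∀ w, A ((1 / σ) • (w - J w)) (J w)) (hJc : Continuous J)
    (hsol : ∃ v u, A v u ∧ G v = -u) (z₀ : E × E) :
    ∃ v u, A v u ∧ G v = -u ∧
      Tendsto (fun k => (primalDualStep G J σ τ)^[k] z₀) atTop (𝓝 (v, u)) := by
  have hα : σ < 1 / τ - κ / 2 := by
    have : σ + κ / 2 < 1 / τ := by rwa [lt_div_iff₀' hτ]
    linarith
  obtain ⟨c, hc, hq⟩ := exists_pos_mul_le_quadratic (E := E) hσ hα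
  have hnorm (z : E × E) : ‖z‖ ^ 2 ≤ ‖z.1‖ ^ 2 + ‖z.2‖ ^ 2 := by
    rw [Prod.norm_def]
    rcases max_cases ‖z.1‖ ‖z.2‖ with h | h <;> rw [h.1] <;>
      nlinarith [sq_nonneg ‖z.1‖, sq_nonneg ‖z.2‖]
  have hq' (z : E × E) : c * ‖z‖ ^ 2
      ≤ (1 / τ - κ / 2) * ‖z.1‖ ^ 2 + 1 / σ * ‖z.2‖ ^ 2 + 2 * inner ℝ z.1 z.2 :=
    (mul_le_mul_of_nonneg_left (hnorm z) hc.le).trans (hq _ _)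
  obtain ⟨⟨v, u⟩, hz, hlim⟩ := tendsto_iterate_of_fejer (T := primalDualStep G J σ τ)
    (q := fun z => 1 / τ * ‖z.1‖ ^ 2 + 1 / σ * ‖z.2‖ ^ 2 + 2 * inner ℝ z.1 z.2)
    (by unfold primalDualStep; fun_prop) (by fun_prop) (by simp) hc
    (fun z => (hq' z).trans (by nlinarith [sq_nonneg ‖z.1‖]))
    (by
      rintro ⟨v', u'⟩ hz' ⟨v, u⟩
      obtain ⟨h1, h2⟩ := (fixed_primalDualStep_iff hA hσ hτ hJ v' u').1 hz'
      have h3 := primalDualStep_fejer hA hG hκ hσ hτ hJ h1 h2 (v := v) (u := u)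
        (Prod.mk.eta (p := primalDualStep G J σ τ (v, u))).symm
      have h4 := hq' (primalDualStep G J σ τ (v, u) - (v, u))
      simp only [Prod.fst_sub, Prod.snd_sub] at h4 ⊢
      linarith)
    (by
      obtain ⟨v, u, h⟩ := hsol
      exact ⟨(v, u), (fixed_primalDualStep_iff hA hσ hτ hJ v u).2 h⟩) z₀
  obtain ⟨h1, h2⟩ := (fixed_primalDualStep_iff hA hσ hτ hJ v u).1 hz
  exact ⟨v, u, h1, h2, hlim⟩

end PrimalDual

/-! ### Conjugates and strong convexity of ψ*. -/

section Conj

variable {d : ℕ} {β σ : ℝ} {ψ : Euc d → ℝ} {D : Euc d → Euc d}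

theorem le_fenchelConj (f : Euc d → EReal) (x z : Euc d) :
    ((inner ℝ x z : ℝ) : EReal) - f x ≤ fenchelConj f z :=
  le_iSup (fun x => ((inner ℝ x z : ℝ) : EReal) - f x) x

theorem fenchelConj_coe_le_coe_iff (f : Euc d → ℝ) (z : Euc d) (r : ℝ) :
    fenchelConj (fun x => (f x : EReal)) z ≤ r ↔ ∀ x, inner ℝ x z - f x ≤ r := by
  simp only [fenchelConj, iSup_le_iff, ← EReal.coe_sub, EReal.coe_le_coe_iff]

theorem fenchelConj_coe_ne_bot (f : Euc d → ℝ) (z : Euc d) :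
    fenchelConj (fun x => (f x : EReal)) z ≠ ⊥ := by
  have := le_fenchelConj (fun x => (f x : EReal)) 0 z
  rw [← EReal.coe_sub] at this
  exact ((EReal.bot_lt_coe _).trans_le this).ne'

theorem fenchelConj_coe_cases (f : Euc d → ℝ) (z : Euc d) :
    fenchelConj (fun x => (f x : EReal)) z = ⊤ ∨
      ∃ r : ℝ, fenchelConj (fun x => (f x : EReal)) z = r := by
  induction h : fenchelConj (fun x => (f x : EReal)) z with
  | bot => exact absurd h (fenchelConj_coe_ne_bot f z)
  | top => exact Or.inl rfl
  | coe r => exact Or.inr ⟨r, rfl⟩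

theorem le_of_fenchelConj_eq_coe {f : Euc d → ℝ} {z : Euc d} {r : ℝ}
    (h : fenchelConj (fun x => (f x : EReal)) z = r) (x : Euc d) : inner ℝ x z - f x ≤ r :=
  (fenchelConj_coe_le_coe_iff f z r).1 h.le x

/-- Equality case of the Fenchel-Young inequality. -/
theorem fenchelConj_coe_eq_of_isSubgradient {f : Euc d → ℝ} {p x : Euc d}
    (h : ∀ y, f x + inner ℝ p (y - x) ≤ f y) :
    fenchelConj (fun x => (f x : EReal)) p = (inner ℝ x p - f x : ℝ) := by
  refine le_antisymm ((fenchelConj_coe_le_coe_iff _ _ _).2 fun y => ?_) ?_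
  · have := h y
    rw [inner_sub_right, real_inner_comm, real_inner_comm x] at this
    linarith
  · rw [EReal.coe_sub]
    exact le_fenchelConj (fun x => (f x : EReal)) x p

theorem IsMoLGrad.fenchelConj_apply (hD : IsMoLGrad β ψ D) (x : Euc d) :
    fenchelConj (fun x => (ψ x : EReal)) (D x) = (inner ℝ x (D x) - ψ x : ℝ) :=
  fenchelConj_coe_eq_of_isSubgradient (hD.convex.add_inner_le (hD.gradient x))

/-- The strong subgradient inequality of `ψ*` at `D w`. -/
theorem IsMoLGrad.le_fenchelConj (hD : IsMoLGrad β ψ D) (hβ : 0 < β) {w z : Euc d} {r : ℝ}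
    (hr : fenchelConj (fun x => (ψ x : EReal)) z = r) :
    inner ℝ w z - ψ w + β / 2 * ‖z - D w‖ ^ 2 ≤ r := by
  -- This point maximizes the lower bound on ⟨·, z⟩ - ψ given by the descent lemma at w.
  have h1 := le_of_fenchelConj_eq_coe hr (w + β • (z - D w))
  have h2 := le_add_inner_add_sq_of_lipschitz_gradient hD.gradient hD.lipschitz w (β • (z - D w))
  rw [inner_add_left, real_inner_smul_left] at h1
  rw [real_inner_smul_right, norm_smul, mul_pow, Real.norm_eq_abs, sq_abs,
    real_inner_comm (z - D w)] at h2
  have h3 : β⁻¹ / 2 * (β ^ 2 * ‖z - D w‖ ^ 2) = β / 2 * ‖z - D w‖ ^ 2 := by field_simp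
  have h4 : β * inner ℝ (z - D w) z - β * inner ℝ (z - D w) (D w) = β * ‖z - D w‖ ^ 2 := by
    rw [← mul_sub, ← inner_sub_right, real_inner_self_eq_norm_sq]
  linarith

/-- The conjugate of a function with `β⁻¹`-Lipschitz gradient is `β`-strongly convex. -/
theorem IsMoLGrad.fenchelConj_le (hD : IsMoLGrad β ψ D) (hβ : 0 < β) {y z : Euc d} {r s t : ℝ}
    (hr : fenchelConj (fun x => (ψ x : EReal)) y = r)
    (hs : fenchelConj (fun x => (ψ x : EReal)) z = s) (ht0 : 0 ≤ t) (ht1 : t ≤ 1) :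
    fenchelConj (fun x => (ψ x : EReal)) (y + t • (z - y))
      ≤ ((1 - t) * r + t * s - β / 2 * t * (1 - t) * ‖z - y‖ ^ 2 : ℝ) := by
  refine (fenchelConj_coe_le_coe_iff _ _ _).2 fun x => ?_
  have dl (a : ℝ) := le_add_inner_add_sq_of_lipschitz_gradient hD.gradient hD.lipschitz x
    ((β * a) • (z - y))
  -- The two test points average to x under the weights 1 - t and t, so the gradient terms of ψ
  -- cancel.
  have hy := le_of_fenchelConj_eq_coe hr (x + (β * -t) • (z - y))
  have hz := le_of_fenchelConj_eq_coe hs (x + (β * (1 - t)) • (z - y))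
  have dy := dl (-t)
  have dz := dl (1 - t)
  have e (a : ℝ) : β⁻¹ / 2 * ‖(β * a) • (z - y)‖ ^ 2 = β / 2 * a ^ 2 * ‖z - y‖ ^ 2 := by
    rw [norm_smul, mul_pow, Real.norm_eq_abs, sq_abs]
    field_simp
  rw [e, real_inner_smul_right] at dy dz
  rw [inner_add_left, real_inner_smul_left] at hy hz
  have hn : inner ℝ (z - y) z - inner ℝ (z - y) y = ‖z - y‖ ^ 2 := by
    rw [← inner_sub_right, real_inner_self_eq_norm_sq]
  rw [inner_add_right, real_inner_smul_right, inner_sub_right]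
  have Hy := mul_le_mul_of_nonneg_left (hy.trans' (sub_le_sub_left dy _)) (sub_nonneg.2 ht1)
  have Hz := mul_le_mul_of_nonneg_left (hz.trans' (sub_le_sub_left dz _)) ht0
  have hz' : inner ℝ (z - y) z = inner ℝ (z - y) y + ‖z - y‖ ^ 2 := by linarith
  rw [hz'] at Hz
  linarith

end Conj

/-! ### The regularizer, its subgradients and optimality. -/

section Regularizer

variable {d : ℕ} {β σ : ℝ} {ψ : Euc d → ℝ} {D : Euc d → Euc d}

/-- The value of `(σ+1)φ + (1/2)‖·‖²` at `v` when `ψ* v = r`. -/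
noncomputable def regValue (σ r : ℝ) (v : Euc d) : ℝ := (σ + 1) * (r - 1 / 2 * ‖v‖ ^ 2) + 1 / 2 * ‖v‖ ^ 2

/-- `(σ+1)φ + (1/2)‖·‖²` as an extended-real-valued function. -/
noncomputable def regCost (ψ : Euc d → ℝ) (σ : ℝ) (v : Euc d) : EReal :=
  ((σ + 1 : ℝ) : EReal) * implicitReg ψ v + ((1 / 2 * ‖v‖ ^ 2 : ℝ) : EReal)

/-- `u` is a subgradient of `(σ+1)φ + (1/2)‖·‖²` at `p`. -/
def IsRegSubgradient (ψ : Euc d → ℝ) (σ : ℝ) (p u : Euc d) : Prop :=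
  ∃ r : ℝ, fenchelConj (fun x => (ψ x : EReal)) p = r ∧
    ∀ (z : Euc d) (s : ℝ), fenchelConj (fun x => (ψ x : EReal)) z = s →
      regValue σ r p + inner ℝ u (z - p) ≤ regValue σ s z

theorem regCost_of_top (hσ : 0 < σ) {v : Euc d}
    (h : fenchelConj (fun x => (ψ x : EReal)) v = ⊤) : regCost ψ σ v = ⊤ := by
  rw [regCost, implicitReg, h, EReal.top_sub_coe, EReal.coe_mul_top_of_pos (by linarith),
    EReal.top_add_coe]

theorem regCost_of_coe {v : Euc d} {r : ℝ}
    (h : fenchelConj (fun x => (ψ x : EReal)) v = r) : regCost ψ σ v = (regValue σ r v : ℝ) := by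
  rw [regCost, implicitReg, h]
  rfl

theorem primalCost_of_top (M : Submodule ℝ (Euc d)) (μ : ℝ) (Φ : Euc d → ℝ) (hσ : 0 < σ)
    {v : Euc d} (h : fenchelConj (fun x => (ψ x : EReal)) v = ⊤) :
    primalCost ψ M μ Φ σ v = ⊤ := by
  rw [primalCost, implicitReg, h, EReal.top_sub_coe, EReal.coe_mul_top_of_pos (by linarith),
    EReal.coe_add_top, EReal.top_add_coe]

theorem primalCost_of_coe (M : Submodule ℝ (Euc d)) (μ : ℝ) (Φ : Euc d → ℝ)
    {v : Euc d} {r : ℝ} (h : fenchelConj (fun x => (ψ x : EReal)) v = r) :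
    primalCost ψ M μ Φ σ v = (hFun M μ Φ v + regValue σ r v : ℝ) := by
  rw [primalCost, implicitReg, h, ← EReal.coe_sub, ← EReal.coe_mul, ← EReal.coe_add,
    ← EReal.coe_add, EReal.coe_eq_coe_iff]
  have := Submodule.norm_sq_eq_add_norm_sq_starProjection v M
  simp only [hFun, regValue]
  linarith

theorem IsRegSubgradient.monotone {p u p' u' : Euc d} (h : IsRegSubgradient ψ σ p u)
    (h' : IsRegSubgradient ψ σ p' u') : 0 ≤ inner ℝ (u - u') (p - p') := by
  obtain ⟨r, hr, H⟩ := h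
  obtain ⟨r', hr', H'⟩ := h'
  have h1 := H _ _ hr'
  have h2 := H' _ _ hr
  rw [← neg_sub, inner_neg_right] at h1
  rw [inner_sub_left]
  linarith

/-- The quadratic gain (σ+1)β/2 from strong convexity of (σ+1)ψ* pays for the concave term
-(σ/2)‖·‖². -/
theorem IsMoLGrad.isRegSubgradient (hD : IsMoLGrad β ψ D) (hβ : 0 < β) (hσ : 0 < σ)
    (hσβ : σ ≤ (σ + 1) * β) (w : Euc d) :
    IsRegSubgradient ψ σ (D ((1 / (σ + 1)) • w)) (w - σ • D ((1 / (σ + 1)) • w)) := by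
  obtain ⟨x, rfl⟩ : ∃ x : Euc d, w = (σ + 1) • x :=
    ⟨(1 / (σ + 1)) • w, by rw [smul_smul, mul_one_div_cancel (by linarith), one_smul]⟩
  rw [smul_smul, one_div_mul_cancel (by linarith), one_smul]
  refine ⟨_, hD.fenchelConj_apply x, fun z s hs => ?_⟩
  have h1 := mul_le_mul_of_nonneg_left (hD.le_fenchelConj hβ (w := x) hs)
    (by linarith : 0 ≤ σ + 1)
  have h2 := mul_le_mul_of_nonneg_right hσβ (sq_nonneg ‖z - D x‖)
  simp only [regValue]
  simp only [norm_sub_sq_real] at h1 h2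
  rw [inner_sub_left, real_inner_smul_left, real_inner_smul_left, inner_sub_right,
    inner_sub_right, real_inner_self_eq_norm_sq, real_inner_comm z (D x)]
  linarith

/-- The quadratics in z cancel, leaving ψ*(z) - ⟨x, z⟩ up to a constant; strong convexity makes D x
its only minimizer. -/
theorem IsMoLGrad.isSProx (hD : IsMoLGrad β ψ D) (hβ : 0 < β) : IsSProx 1 (implicitReg ψ) D := by
  have hval {x z : Euc d} {s : ℝ} (hs : fenchelConj (fun x => (ψ x : EReal)) z = s) :
      implicitReg ψ z + ((1 / (2 * 1) * ‖x - z‖ ^ 2 : ℝ) : EReal)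
        = (s - inner ℝ x z + 1 / 2 * ‖x‖ ^ 2 : ℝ) := by
    rw [implicitReg, hs, ← EReal.coe_sub, ← EReal.coe_add, norm_sub_sq_real]
    congr 1
    ring
  have htop {x z : Euc d} (hz : fenchelConj (fun x => (ψ x : EReal)) z = ⊤) :
      implicitReg ψ z + ((1 / (2 * 1) * ‖x - z‖ ^ 2 : ℝ) : EReal) = ⊤ := by
    rw [implicitReg, hz, EReal.top_sub_coe, EReal.top_add_coe]
  intro x y
  constructor
  · intro h
    have h1 := isMinOn_univ_iff.1 h (D x)
    rw [hval (hD.fenchelConj_apply x)] at h1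
    rcases fenchelConj_coe_cases ψ y with hy | ⟨s, hs⟩
    · rw [htop hy, top_le_iff] at h1
      exact absurd h1 (EReal.coe_ne_top _)
    · rw [hval hs, EReal.coe_le_coe_iff] at h1
      have h2 := hD.le_fenchelConj hβ (w := x) hs
      have h3 : β / 2 * ‖y - D x‖ ^ 2 ≤ 0 := by linarith
      rw [← sub_eq_zero, ← norm_eq_zero, ← pow_eq_zero_iff two_ne_zero]
      exact le_antisymm (nonpos_of_mul_nonpos_right h3 (by positivity)) (sq_nonneg _)
  · rintro rfl
    refine isMinOn_univ_iff.2 fun z => ?_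
    rw [hval (hD.fenchelConj_apply x)]
    rcases fenchelConj_coe_cases ψ z with hz | ⟨s, hs⟩
    · rw [htop hz]
      exact le_top
    · rw [hval hs, EReal.coe_le_coe_iff]
      have h2 := hD.le_fenchelConj hβ (w := x) hs
      have : 0 ≤ β / 2 * ‖z - D x‖ ^ 2 := by positivity
      linarith

variable {M : Submodule ℝ (Euc d)} {μ κ : ℝ} {Φ : Euc d → ℝ}

theorem IsRegSubgradient.isMinOn_primalCost (hσ : 0 < σ)
    (hc : ConvexOn ℝ Set.univ (hFun M μ Φ)) {v u : Euc d}
    (hg : HasGradientAt (hFun M μ Φ) (-u) v) (h : IsRegSubgradient ψ σ v u) :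
    IsMinOn (primalCost ψ M μ Φ σ) Set.univ v := by
  obtain ⟨r, hr, H⟩ := h
  refine isMinOn_univ_iff.2 fun z => ?_
  rcases fenchelConj_coe_cases ψ z with hz | ⟨s, hs⟩
  · rw [primalCost_of_top M μ Φ hσ hz]
    exact le_top
  · rw [primalCost_of_coe M μ Φ hr, primalCost_of_coe M μ Φ hs, EReal.coe_le_coe_iff]
    have h1 := H z s hs
    have h2 := hc.add_inner_le hg z
    rw [inner_neg_left] at h2
    linarith

theorem IsRegSubgradient.isMinOn_dualCost (hσ : 0 < σ)
    (hc : ConvexOn ℝ Set.univ (hFun M μ Φ)) {v u : Euc d}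
    (hg : HasGradientAt (hFun M μ Φ) (-u) v) (h : IsRegSubgradient ψ σ v u) :
    IsMinOn (dualCost ψ M μ Φ σ) Set.univ u := by
  obtain ⟨r, hr, H⟩ := h
  have h1 : fenchelConj (fun v => (hFun M μ Φ v : EReal)) (-u)
      = (inner ℝ v (-u) - hFun M μ Φ v : ℝ) :=
    fenchelConj_coe_eq_of_isSubgradient (hc.add_inner_le hg)
  have h2 : fenchelConj (regCost ψ σ) u ≤ (inner ℝ v u - regValue σ r v : ℝ) := by
    refine iSup_le fun z => ?_
    rcases fenchelConj_coe_cases ψ z with hz | ⟨s, hs⟩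
    · rw [regCost_of_top hσ hz, EReal.sub_top]
      exact bot_le
    · rw [regCost_of_coe hs, ← EReal.coe_sub, EReal.coe_le_coe_iff]
      have := H z s hs
      rw [inner_sub_right, real_inner_comm, real_inner_comm v] at this
      linarith
  refine isMinOn_univ_iff.2 fun w => ?_
  have h3 := le_fenchelConj (fun v => (hFun M μ Φ v : EReal)) v (-w)
  have h4 := le_fenchelConj (regCost ψ σ) v w
  rw [regCost_of_coe hr] at h4
  calc dualCost ψ M μ Φ σ u
      ≤ (inner ℝ v (-u) - hFun M μ Φ v : ℝ) + (inner ℝ v u - regValue σ r v : ℝ) :=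
        add_le_add h1.le h2
    _ = (inner ℝ v (-w) - hFun M μ Φ v : ℝ) + (inner ℝ v w - regValue σ r v : ℝ) := by
        rw [← EReal.coe_add, ← EReal.coe_add, inner_neg_right, inner_neg_right]
        congr 1
        ring
    _ ≤ dualCost ψ M μ Φ σ w := add_le_add h3 h4

/-- First-order optimality condition for the primal problem. -/
theorem IsMoLGrad.isRegSubgradient_of_isMinOn_primalCost (hD : IsMoLGrad β ψ D) (hβ : 0 < β)
    (hσ : 0 < σ) (hσβ : σ ≤ (σ + 1) * β) {G : Euc d → Euc d}
    (hG : ∀ x, HasGradientAt (hFun M μ Φ) (G x) x)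
    (hL : ∀ x y, ‖G x - G y‖ ≤ κ * ‖x - y‖) {v : Euc d}
    (hv : IsMinOn (primalCost ψ M μ Φ σ) Set.univ v) : IsRegSubgradient ψ σ v (-G v) := by
  obtain ⟨r, hr⟩ : ∃ r : ℝ, fenchelConj (fun x => (ψ x : EReal)) v = r := by
    refine (fenchelConj_coe_cases ψ v).resolve_left fun h => ?_
    have := isMinOn_univ_iff.1 hv (D 0)
    rw [primalCost_of_top M μ Φ hσ h, primalCost_of_coe M μ Φ (hD.fenchelConj_apply 0),
      top_le_iff] at this
    exact EReal.coe_ne_top _ this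
  refine ⟨r, hr, fun z s hs => ?_⟩
  -- Minimality is tested at v + t(z - v), using convexity of g on the segment and the descent lemma
  -- for h. Dividing by t leaves an error that vanishes as t → 0.
  have key (t : ℝ) (ht : t ∈ Set.Ioc (0 : ℝ) 1) :
      regValue σ r v - regValue σ s z - inner ℝ (G v) (z - v) ≤ t * (κ / 2 * ‖z - v‖ ^ 2) := by
    obtain ⟨ht0, ht1⟩ := ht
    have h1 := hD.fenchelConj_le hβ hr hs ht0.le ht1
    have h2 := isMinOn_univ_iff.1 hv (v + t • (z - v))
    rcases fenchelConj_coe_cases ψ (v + t • (z - v)) with h | ⟨q, hq⟩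
    · rw [h, top_le_iff] at h1
      exact absurd h1 (EReal.coe_ne_top _)
    rw [hq, EReal.coe_le_coe_iff] at h1
    rw [primalCost_of_coe M μ Φ hr, primalCost_of_coe M μ Φ hq, EReal.coe_le_coe_iff] at h2
    have h3 := le_add_inner_add_sq_of_lipschitz_gradient hG hL v (t • (z - v))
    rw [real_inner_smul_right, norm_smul, mul_pow, Real.norm_eq_abs, sq_abs] at h3
    have h4 : ‖v + t • (z - v)‖ ^ 2
        = (1 - t) * ‖v‖ ^ 2 + t * ‖z‖ ^ 2 - t * (1 - t) * ‖z - v‖ ^ 2 := by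
      rw [norm_add_sq_real, real_inner_smul_right, norm_smul, mul_pow, Real.norm_eq_abs, sq_abs,
        norm_sub_sq_real, inner_sub_right, real_inner_self_eq_norm_sq, real_inner_comm z]
      ring
    have h5 := mul_le_mul_of_nonneg_left h1 (by linarith : 0 ≤ σ + 1)
    have h6 := mul_le_mul_of_nonneg_right hσβ
      (mul_nonneg (mul_nonneg ht0.le (sub_nonneg.2 ht1)) (sq_nonneg ‖z - v‖))
    refine le_of_mul_le_mul_left ?_ ht0
    simp only [regValue, h4] at h2 ⊢
    linarith
  have hlim : Filter.Tendsto (fun t : ℝ => t * (κ / 2 * ‖z - v‖ ^ 2))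
      (nhdsWithin 0 (Set.Ioi 0)) (nhds 0) := by
    have : Continuous fun t : ℝ => t * (κ / 2 * ‖z - v‖ ^ 2) := by fun_prop
    simpa using (this.tendsto 0).mono_left nhdsWithin_le_nhds
  have := ge_of_tendsto hlim (Filter.mem_of_superset (Ioc_mem_nhdsGT one_pos) key)
  rw [inner_neg_left]
  linarith

theorem hasGradientAt_penalizedFidelity {g v : Euc d} (hg : HasGradientAt (hFun M μ Φ) g v) :
    HasGradientAt (penalizedFidelity M μ Φ) (g + v) v := by
  have h : penalizedFidelity M μ Φ = fun x => hFun M μ Φ x + 1 / 2 * ‖x‖ ^ 2 := by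
    funext x
    have := Submodule.norm_sq_eq_add_norm_sq_starProjection x M
    simp only [hFun, penalizedFidelity]
    linarith
  rw [h, hasGradientAt_iff_hasFDerivAt]
  refine (hg.hasFDerivAt.add
    ((hasStrictFDerivAt_norm_sq v).hasFDerivAt.const_mul (1 / 2))).congr_fderiv ?_
  ext w
  simp

/-- The penalized gradient is ∇h(v) + v, so the extra τv cancels against the factor 1 + τ. -/
theorem primalDualIter_eq_iterate (hd : Differentiable ℝ (hFun M μ Φ)) (τ : ℝ) (v₀ u₀ : Euc d)
    (k : ℕ) : primalDualIter D M μ Φ σ τ v₀ u₀ k =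
      (primalDualStep (∇ (hFun M μ Φ)) (fun w => w - σ • D ((1 / (σ + 1)) • w)) σ τ)^[k]
        (v₀, u₀) := by
  induction k with
  | zero => rfl
  | succ k ih =>
    rw [Function.iterate_succ_apply', ← ih]
    simp only [primalDualIter, primalDualStep, Prod.mk.injEq, and_true]
    rw [(hasGradientAt_penalizedFidelity (hd _).hasGradientAt).gradient]
    module

end Regularizer

theorem proposition1 (d : ℕ) (β : ℝ) (hβ0 : 0 < β) (hβ1 : β < 1)
    (ψ : Euc d → ℝ) (D : Euc d → Euc d) (hD : IsMoLGrad β ψ D) :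
    IsSProx 1 (implicitReg ψ) D ∧
    ∀ (M : Submodule ℝ (Euc d)) (Φ : Euc d → ℝ) (μ κ σ τ : ℝ),
      0 < μ → 0 < κ → 0 < σ → 0 < τ →
      -- `Φ` is convex, smooth, and `1/μ`-strongly convex over `M`
      ConvexOn ℝ Set.univ Φ → (∃ L : ℝ, IsSmoothWith L Φ) →
      StrongConvexOn (M : Set (Euc d)) (1 / μ) Φ →
      -- `h` is convex and `κ`-smooth
      ConvexOn ℝ Set.univ (hFun M μ Φ) → IsSmoothWith κ (hFun M μ Φ) →
      -- step sizes
      σ ≤ β / (1 - β) → τ * (σ + κ / 2) < 1 →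
      -- existence of primal and dual solutions
      (∃ v, IsMinOn (primalCost ψ M μ Φ σ) Set.univ v) →
      (∃ u, IsMinOn (dualCost ψ M μ Φ σ) Set.univ u) →
      ∀ v₀ u₀ : Euc d, ∃ v u : Euc d,
        IsMinOn (primalCost ψ M μ Φ σ) Set.univ v ∧
        IsMinOn (dualCost ψ M μ Φ σ) Set.univ u ∧
        Filter.Tendsto (fun k => (primalDualIter D M μ Φ σ τ v₀ u₀ k).1)
          Filter.atTop (nhds v) ∧
        Filter.Tendsto (fun k => (primalDualIter D M μ Φ σ τ v₀ u₀ k).2)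
          Filter.atTop (nhds u) := by
  refine ⟨hD.isSProx hβ0, fun M Φ μ κ σ τ _ hκ hσ hτ _ _ _ hc hs hσβ hστ hprimal _ v₀ u₀ => ?_⟩
  obtain ⟨hd, hL⟩ := hs
  have hσβ' : σ ≤ (σ + 1) * β := by
    rw [le_div_iff₀ (sub_pos.2 hβ1)] at hσβ
    linarith
  have hG (x : Euc d) : HasGradientAt (hFun M μ Φ) (∇ (hFun M μ Φ) x) x := (hd x).hasGradientAt
  have hGc : Continuous (∇ (hFun M μ Φ)) :=
    (LipschitzWith.of_dist_le_mul (K := ⟨κ, hκ.le⟩) fun x y => by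
      rw [dist_eq_norm, dist_eq_norm]
      exact hL x y).continuous
  have hDc : Continuous D :=
    (LipschitzWith.of_dist_le_mul (K := ⟨β⁻¹, inv_nonneg.2 hβ0.le⟩) fun x y => by
      rw [dist_eq_norm, dist_eq_norm]
      exact hD.lipschitz x y).continuous
  obtain ⟨v', hv'⟩ := hprimal
  obtain ⟨v, u, hvu, hgu, hlim⟩ := tendsto_iterate_primalDualStep (A := IsRegSubgradient ψ σ)
    (G := ∇ (hFun M μ Φ)) (J := fun w => w - σ • D ((1 / (σ + 1)) • w))
    (fun _ _ _ _ h h' => h.monotone h')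
    (cocoercive_of_lipschitz_gradient hκ hc hG hL) hGc hκ hσ hτ hστ
    (fun w => by
      rw [sub_sub_cancel, smul_smul (1 / σ), one_div_mul_cancel hσ.ne', one_smul]
      exact hD.isRegSubgradient hβ0 hσ hσβ' w)
    (by fun_prop)
    -- The dual component is -∇h(v').
    ⟨v', _, hD.isRegSubgradient_of_isMinOn_primalCost hβ0 hσ hσβ' hG hL hv', (neg_neg _).symm⟩
    (v₀, u₀)
  have hgv : HasGradientAt (hFun M μ Φ) (-u) v := hgu ▸ hG v
  simp only [primalDualIter_eq_iterate hd]
  exact ⟨v, u, hvu.isMinOn_primalCost hσ hc hgv, hvu.isMinOn_dualCost hσ hc hgv,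
    (continuous_fst.tendsto _).comp hlim, (continuous_snd.tendsto _).comp hlim⟩
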